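/- For a finite connected simple graph $G$ with vertex set $V(G)$ and shortest-path distance $d$, a set $W\subseteq V(G)$ is a resolving set of $G$ if for every two distinct vertices $u,v\in V(G)$ there is some $x\in W$ with $d(u,x)\ne d(v,x)$. The metric dimension $\dim(G)$ is the minimum cardinality of a resolving set of $G$. Theorem 3.1. Let $T$ be a finite tree of order at least $3$, let $e\in E(\overline T)$ be an edge of the complement of $T$, and let $T+e$ be the graph obtained from $T$ by adding the edge $e$. Then $$\dim(T)-2\le\dim(T+e)\le\dim(T)+1.$$ -/

import Mathlib

/-- The vertex `x` resolves the pair `u, v` if its distances to `u` and `v` differ. -/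
def SimpleGraph.Resolves {V : Type*} (G : SimpleGraph V) (x u v : V) : Prop :=
  G.dist u x ≠ G.dist v x

/-- `W` is a resolving set of `G` if every pair of distinct vertices is resolved by some vertex
of `W`. -/
def SimpleGraph.IsResolvingSet {V : Type*} (G : SimpleGraph V) (W : Finset V) : Prop :=
  ∀ u v : V, u ≠ v → ∃ x ∈ W, G.Resolves x u v

/-- The metric dimension: the minimum cardinality of a resolving set. It is meant for finite
connected graphs, where distances are genuine and the set of all vertices is resolving. -/
noncomputable def SimpleGraph.metricDim {V : Type*} (G : SimpleGraph V) : ℕ :=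
  sInf {k : ℕ | ∃ W : Finset V, G.IsResolvingSet W ∧ W.card = k}

/-- The graph `G + e` obtained from `G` by attaching the edge `e`. -/
def SimpleGraph.addEdge {V : Type*} (G : SimpleGraph V) (e : Sym2 V) : SimpleGraph V :=
  G ⊔ SimpleGraph.fromEdgeSet {e}

/-- On a finite connected graph the minimum defining the metric dimension is attained. -/
theorem SimpleGraph.Connected.exists_isResolvingSet_card_eq_metricDim {V : Type*} [Fintype V]
    {G : SimpleGraph V} (hG : G.Connected) :
    ∃ W : Finset V, G.IsResolvingSet W ∧ W.card = G.metricDim := by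
  refine Nat.sInf_mem (s := {k : ℕ | ∃ W : Finset V, G.IsResolvingSet W ∧ W.card = k})
    ⟨_, Finset.univ, fun u v huv => ⟨v, Finset.mem_univ v, ?_⟩, rfl⟩
  unfold SimpleGraph.Resolves
  rw [SimpleGraph.dist_self]
  exact (hG.pos_dist_of_ne huv).ne'

/-! ### Distances in trees -/

namespace SimpleGraph

variable {V : Type*}

/-! Lower bound: a distance in `T + e` is determined by the distances in `T` to the target and to
the ends `a`, `b` of `e`, so adding `a` and `b` to a resolving set of `T + e` resolves `T`.

Upper bound: each vertex hangs at some height over a position of the path from `a` to `b`, which `e`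
closes to a cycle. A resolving set `W` of `T` still separates vertices over the same position. If
`W` meets two positions, one more vertex completes a triple not contained in a short arc; such a
triple is doubly resolving (`cycDist_geodesic_triple_resolves`), which neutralizes the heights
(`cycDist_sub_eq_clamp`). Otherwise `W` hangs over a single end, say `a`; the tree outside that
branch is then a path, and its far end is added. -/

theorem IsTree.eq_of_adj_of_dist_add_one {T : SimpleGraph V} (hT : T.IsTree) {x d d' d'' : V}
    (h' : T.Adj d d') (h'' : T.Adj d d'') (e' : T.dist d x = T.dist d' x + 1)
    (e'' : T.dist d x = T.dist d'' x + 1) : d' = d'' := by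
  obtain ⟨p, hp⟩ := hT.connected.exists_walk_length_eq_dist d' x
  obtain ⟨q, hq⟩ := hT.connected.exists_walk_length_eq_dist d'' x
  have hp' : (Walk.cons h' p).IsPath := Walk.isPath_of_length_eq_dist _ (by simp [hp, e'])
  have hq' : (Walk.cons h'' q).IsPath := Walk.isPath_of_length_eq_dist _ (by simp [hq, e''])
  have h := congrArg Walk.snd ((hT.existsUnique_path d x).unique hp' hq')
  simpa using h

theorem IsTree.dist_cases_of_adj {T : SimpleGraph V} (hT : T.IsTree) (x : V) {d d' : V}
    (h : T.Adj d d') : T.dist d x = T.dist d' x + 1 ∨ T.dist d' x = T.dist d x + 1 := by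
  have := hT.dist_eq_dist_add_one_of_adj x h
  rw [T.dist_comm (u := x), T.dist_comm (u := x)] at this
  exact this

theorem Connected.exists_adj_dist_eq_add_one {G : SimpleGraph V} (hG : G.Connected) {u v : V}
    (h : u ≠ v) : ∃ u', G.Adj u u' ∧ G.dist u v = G.dist u' v + 1 := by
  obtain ⟨p, hp⟩ := hG.exists_walk_length_eq_dist u v
  cases p with
  | nil => exact absurd rfl h
  | @cons _ w _ hadj q =>
    refine ⟨w, hadj, ?_⟩
    have h1 := G.dist_le q
    have h2 := hG.dist_triangle (u := u) (v := w) (w := v)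
    rw [dist_eq_one_iff_adj.mpr hadj] at h2
    simp only [Walk.length_cons] at hp
    omega

/-- In a tree, a vertex whose first steps towards `a` and `b` differ lies between them. -/
theorem IsTree.dist_eq_add_of_adj {T : SimpleGraph V} (hT : T.IsTree) {a b : V} (n : ℕ) :
    ∀ {d d' : V}, T.dist d b = n → T.Adj d d' → T.dist d' a = T.dist d a + 1 →
      T.dist d b = T.dist d' b + 1 → T.dist a b = T.dist d a + T.dist d b := by
  induction n with
  | zero => intro d d' h _ _ h'; omega
  | succ n ih =>
    intro d d' hn hadj ha hb
    by_cases hd : d' = b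
    · subst hd
      rw [T.dist_comm, ha, hb, dist_self]
    · obtain ⟨d'', hadj', hb'⟩ := hT.connected.exists_adj_dist_eq_add_one hd
      have hne : d ≠ d'' := by rintro rfl; omega
      have ha' : T.dist d'' a = T.dist d' a + 1 := by
        rcases hT.dist_cases_of_adj a hadj' with h | h
        · exact absurd (hT.eq_of_adj_of_dist_add_one hadj.symm hadj' ha h) hne
        · exact h
      have := ih (by omega) hadj' ha' hb'
      omega

theorem IsTree.even_dist_add_dist_add_dist {T : SimpleGraph V} (hT : T.IsTree) (u a b : V) :
    Even (T.dist u a + T.dist u b + T.dist a b) := by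
  induction h : T.dist u a generalizing u with
  | zero =>
    obtain rfl := (hT.connected.dist_eq_zero_iff).mp h
    simp
  | succ n ih =>
    have hne : u ≠ a := by rintro rfl; simp at h
    obtain ⟨u', hadj, hu⟩ := hT.connected.exists_adj_dist_eq_add_one hne
    have := ih u' (by omega)
    rw [Nat.even_iff] at this ⊢
    rcases hT.dist_cases_of_adj b hadj with h | h <;> omega

/-- The four-point condition: of the three sums, the two largest agree. -/
theorem IsTree.dist_add_dist_le_max {T : SimpleGraph V} (hT : T.IsTree) (a b c d : V) :
    T.dist a b + T.dist d c ≤ max (T.dist a c + T.dist d b) (T.dist d a + T.dist b c) ∧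
    T.dist a c + T.dist d b ≤ max (T.dist a b + T.dist d c) (T.dist d a + T.dist b c) ∧
    T.dist d a + T.dist b c ≤ max (T.dist a b + T.dist d c) (T.dist a c + T.dist d b) := by
  have tri := fun u v w => hT.connected.dist_triangle (u := u) (v := v) (w := w)
  induction h : T.dist d a generalizing d with
  | zero =>
    obtain rfl := (hT.connected.dist_eq_zero_iff).mp h
    have h1 := T.dist_comm (u := b) (v := d)
    have := tri b d c
    omega
  | succ n ih =>
    have hne : d ≠ a := by rintro rfl; simp at h
    obtain ⟨d', hadj, hd⟩ := hT.connected.exists_adj_dist_eq_add_one hne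
    have i := ih d' (by omega)
    have hb := fun x y (hx : T.dist d' x = T.dist d x + 1) (hy : T.dist d y = T.dist d' y + 1) =>
      hT.dist_eq_add_of_adj (a := x) (b := y) _ rfl hadj hx hy
    have t1 := tri a d b
    have t2 := tri a d c
    have t3 := tri b d c
    rw [T.dist_comm (u := a) (v := d)] at t1 t2
    rw [T.dist_comm (u := b) (v := d)] at t3
    have e1 := T.dist_comm (u := b) (v := a)
    have e2 := T.dist_comm (u := c) (v := a)
    have e3 := T.dist_comm (u := c) (v := b)
    -- If the step to `d'` approaches `b` and `c` too, all three sums drop by one. Otherwise `d`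
    -- lies between the vertices approached and those receded from.
    rcases hT.dist_cases_of_adj b hadj with h1 | h1 <;>
    rcases hT.dist_cases_of_adj c hadj with h2 | h2
    · omega
    · have := hb c a h2 hd
      have := hb c b h2 h1
      omega
    · have := hb b a h1 hd
      have := hb b c h1 h2
      omega
    · have := hb b a h1 hd
      have := hb c a h2 hd
      omega

theorem Connected.exists_dist_eq_of_le {G : SimpleGraph V} (hG : G.Connected) (u v : V) {k : ℕ}
    (hk : k ≤ G.dist u v) : ∃ w, G.dist u w = k ∧ G.dist w v + k = G.dist u v := by
  obtain ⟨p, hp⟩ := hG.exists_walk_length_eq_dist u v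
  refine ⟨p.getVert k, ?_⟩
  have h1 := G.dist_le (p.take k)
  have h2 := G.dist_le (p.drop k)
  have h3 := hG.dist_triangle (u := u) (v := p.getVert k) (w := v)
  rw [Walk.take_length] at h1
  rw [Walk.drop_length] at h2
  omega

/-! ### Distances after adding an edge, and the lower bound -/

theorem le_addEdge (G : SimpleGraph V) (e : Sym2 V) : G ≤ G.addEdge e := le_sup_left

theorem dist_addEdge {G : SimpleGraph V} (hG : G.Connected) {a b : V} (hab : a ≠ b) (u v : V) :
    (G.addEdge s(a, b)).dist u v =
      min (G.dist u v) (min (G.dist u a + 1 + G.dist v b) (G.dist u b + 1 + G.dist v a)) := by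
  have hH : (G.addEdge s(a, b)).Connected := hG.mono (G.le_addEdge _)
  have mono : ∀ x y, (G.addEdge s(a, b)).dist x y ≤ G.dist x y := fun x y =>
    (hG x y).dist_anti (G.le_addEdge _)
  have hadj : (G.addEdge s(a, b)).dist a b = 1 := dist_eq_one_iff_adj.mpr (by simp [addEdge, hab])
  -- The formula vanishes at `u = v` and changes by at most one along each edge of the new graph.
  have key : ∀ u v (p : (G.addEdge s(a, b)).Walk u v),
      min (G.dist u v) (min (G.dist u a + 1 + G.dist v b) (G.dist u b + 1 + G.dist v a))
        ≤ p.length := by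
    intro u v p
    induction p with
    | nil => simp
    | @cons u w v h p ih =>
      rw [Walk.length_cons]
      have hcase : G.Adj u w ∨ (u = a ∧ w = b) ∨ (u = b ∧ w = a) := by
        simp only [addEdge, sup_adj, fromEdgeSet_adj, Set.mem_singleton_iff, Sym2.eq_iff] at h
        tauto
      rcases hcase with h | ⟨rfl, rfl⟩ | ⟨rfl, rfl⟩
      · have tri := fun x => hG.dist_triangle (u := u) (v := w) (w := x)
        rw [dist_eq_one_iff_adj.mpr h] at tri
        have := tri v
        have := tri a
        have := tri b
        omega
      · simp only [dist_self] at ih ⊢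
        have := G.dist_comm (u := v) (v := u)
        have := G.dist_comm (u := v) (v := w)
        omega
      · simp only [dist_self] at ih ⊢
        have := G.dist_comm (u := v) (v := u)
        have := G.dist_comm (u := v) (v := w)
        omega
  apply le_antisymm
  · have t1 := hH.dist_triangle (u := u) (v := a) (w := v)
    have t2 := hH.dist_triangle (u := a) (v := b) (w := v)
    have t3 := hH.dist_triangle (u := u) (v := b) (w := v)
    have t4 := hH.dist_triangle (u := b) (v := a) (w := v)
    rw [(G.addEdge s(a, b)).dist_comm (u := b) (v := a), hadj] at t4
    rw [hadj] at t2
    have := mono u v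
    have := mono u a
    have := mono u b
    have := mono a v
    have := mono b v
    have := G.dist_comm (u := v) (v := a)
    have := G.dist_comm (u := v) (v := b)
    omega
  · obtain ⟨p, hp⟩ := hH.exists_walk_length_eq_dist u v
    exact hp ▸ key u v p

theorem metricDim_le {G : SimpleGraph V} {W : Finset V} (h : G.IsResolvingSet W) :
    G.metricDim ≤ W.card := Nat.sInf_le ⟨W, h, rfl⟩

theorem metricDim_le_metricDim_addEdge_add_two [Fintype V] {G : SimpleGraph V} (hG : G.Connected)
    {a b : V} (hab : a ≠ b) : G.metricDim ≤ (G.addEdge s(a, b)).metricDim + 2 := by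
  classical
  obtain ⟨W, hW, hcard⟩ :=
    (hG.mono (G.le_addEdge s(a, b))).exists_isResolvingSet_card_eq_metricDim
  have hres : G.IsResolvingSet (W ∪ {a, b}) := by
    intro u v huv
    by_contra! hno
    simp only [Resolves, not_not] at hno
    obtain ⟨x, hx, hne⟩ := hW u v huv
    apply hne
    rw [dist_addEdge hG hab, dist_addEdge hG hab, hno x (by simp [hx]), hno a (by simp),
      hno b (by simp)]
  calc G.metricDim ≤ (W ∪ {a, b}).card := metricDim_le hres
    _ ≤ W.card + ({a, b} : Finset V).card := Finset.card_union_le _ _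
    _ ≤ _ := by rw [hcard]; exact Nat.add_le_add_left Finset.card_le_two _

end SimpleGraph

/-! ### Arithmetic of distances on a cycle -/

/-- The distance between `i` and `j` along a cycle of length `n`, for `i, j < n`. -/
def cycDist (n i j : ℕ) : ℕ := min (i - j + (j - i)) (n - (i - j + (j - i)))

theorem cycDist_comm (n i j : ℕ) : cycDist n i j = cycDist n j i := by
  unfold cycDist; rw [add_comm]

theorem cycDist_triangle {n i j k : ℕ} (hi : i < n) (hj : j < n) (hk : k < n) :
    cycDist n i k ≤ cycDist n i j + cycDist n j k := by
  unfold cycDist; omega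

theorem cycDist_self (n i : ℕ) : cycDist n i i = 0 := by
  unfold cycDist; omega

theorem cycDist_pos {n i j : ℕ} (hi : i < n) (hj : j < n) (hij : i ≠ j) : 0 < cycDist n i j := by
  unfold cycDist; omega

theorem eq_or_reflected_of_cycDist_eq {n i j x : ℕ} (hi : i < n) (hj : j < n) (hx : x < n)
    (h : cycDist n i x = cycDist n j x) :
    i = j ∨ i + j = 2 * x ∨ i + j = 2 * x + n ∨ i + j + n = 2 * x := by
  unfold cycDist at h; omega

/-- Every position lies on a shortest arc between two members of a geodesic triple. -/
theorem exists_cycDist_add_eq {n i x y z : ℕ} (hi : i < n)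
    (hxy : x < y) (hyz : y < z) (hz : z < n) (h1 : 2 * (y - x) ≤ n) (h2 : 2 * (z - y) ≤ n)
    (h3 : n ≤ 2 * (z - x)) :
    cycDist n i x + cycDist n i y = cycDist n x y ∨ cycDist n i y + cycDist n i z = cycDist n y z ∨
      cycDist n i x + cycDist n i z = cycDist n x z := by
  by_cases hx : i < x
  · right; right; unfold cycDist; omega
  by_cases hy : i < y
  · left; unfold cycDist; omega
  by_cases hz : i < z
  · right; left; unfold cycDist; omega
  · right; right; unfold cycDist; omega

/-- As `i` lies on a shortest arc between two of the three positions, its distances to these two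
have the smallest possible sum; both differ from those of `j` by the same amount, which is thus not
positive. -/
theorem cycDist_geodesic_triple_le {n i j x y z : ℕ} (hi : i < n) (hj : j < n)
    (hxy : x < y) (hyz : y < z) (hz : z < n) (h1 : 2 * (y - x) ≤ n) (h2 : 2 * (z - y) ≤ n)
    (h3 : n ≤ 2 * (z - x))
    (e1 : cycDist n i x + cycDist n j y = cycDist n j x + cycDist n i y)
    (e2 : cycDist n i x + cycDist n j z = cycDist n j x + cycDist n i z) :
    cycDist n i x ≤ cycDist n j x := by
  have t1 := cycDist_triangle (n := n) (i := x) (j := j) (k := y) (by omega) hj (by omega)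
  have t2 := cycDist_triangle (n := n) (i := y) (j := j) (k := z) (by omega) hj (by omega)
  have t3 := cycDist_triangle (n := n) (i := x) (j := j) (k := z) (by omega) hj (by omega)
  rw [cycDist_comm n x j] at t1 t3
  rw [cycDist_comm n y j] at t2
  rcases exists_cycDist_add_eq hi hxy hyz hz h1 h2 h3 with h | h | h <;> omega

theorem cycDist_zero_right (n i : ℕ) : cycDist n i 0 = min i (n - i) := by
  unfold cycDist; simp

theorem cycDist_last {n i : ℕ} (hi : i ≤ n) : cycDist (n + 1) i n = min (n - i) (i + 1) := by
  unfold cycDist; omega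

/-- Three positions on a cycle not contained in an arc shorter than half of the cycle are doubly
resolving. -/
theorem cycDist_geodesic_triple_resolves {n i j x y z : ℕ} (hi : i < n) (hj : j < n)
    (hxy : x < y) (hyz : y < z) (hz : z < n) (h1 : 2 * (y - x) ≤ n) (h2 : 2 * (z - y) ≤ n)
    (h3 : n ≤ 2 * (z - x))
    (e1 : cycDist n i x + cycDist n j y = cycDist n j x + cycDist n i y)
    (e2 : cycDist n i x + cycDist n j z = cycDist n j x + cycDist n i z) : i = j := by
  have l1 := cycDist_geodesic_triple_le hi hj hxy hyz hz h1 h2 h3 e1 e2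
  have l2 := cycDist_geodesic_triple_le hj hi hxy hyz hz h1 h2 h3 e1.symm e2.symm
  -- If `i ≠ j`, then `i + j` is congruent to `2x`, `2y` and `2z` modulo `n`, but doubling is at
  -- most two-to-one.
  have r1 := eq_or_reflected_of_cycDist_eq (x := x) hi hj (by omega) (by omega)
  have r2 := eq_or_reflected_of_cycDist_eq (x := y) hi hj (by omega) (by omega)
  have r3 := eq_or_reflected_of_cycDist_eq (x := z) hi hj (by omega) (by omega)
  omega

/-- Weighted positions on a cycle at the same distance from a third one: the difference of the
cyclic distances is the truncated difference of the weights. -/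
theorem cycDist_sub_eq_clamp {n i j x p hu hv c : ℕ} (hi : i < n) (hj : j < n) (hx : x < n)
    (hij : i ≠ j)
    (pu : p ≤ hu + c + cycDist n i x) (pu' : i ≠ x → p = hu + c + cycDist n i x)
    (pv : p ≤ hv + c + cycDist n j x) (pv' : j ≠ x → p = hv + c + cycDist n j x) :
    (cycDist n i x : ℤ) - cycDist n j x =
      max (-(cycDist n i j : ℤ)) (min (cycDist n i j) ((hv : ℤ) - hu)) := by
  have hp := cycDist_pos hi hj hij
  have e := cycDist_comm n i j
  by_cases h1 : i = x
  · subst h1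
    -- Over the same position only an upper bound on `p` is known; it forces `hv - hu` to or below
    -- the lower end of the clamp.
    have := pv' (Ne.symm hij)
    rw [cycDist_self] at *
    omega
  by_cases h2 : j = x
  · subst h2
    have := pu' hij
    rw [cycDist_self] at *
    omega
  have := pu' h1
  have := pv' h2
  have t1 := cycDist_triangle hi hj hx
  have t2 := cycDist_triangle hj hi hx
  omega

/-- The third position halves the longer of the two arcs, possibly wrapping past `0`. -/
theorem exists_geodesic_triple {n x y : ℕ} (hn : 3 ≤ n) (hxy : x < y) (hy : y < n) :
    ∃ z < n, z ≠ x ∧ z ≠ y ∧ ∃ p q r, p < q ∧ q < r ∧ r < n ∧ 2 * (q - p) ≤ n ∧ 2 * (r - q) ≤ n ∧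
      n ≤ 2 * (r - p) ∧ (p = x ∨ p = y ∨ p = z) ∧ (q = x ∨ q = y ∨ q = z) ∧
      (r = x ∨ r = y ∨ r = z) := by
  by_cases h : n < 2 * (y - x)
  · exact ⟨x + (y - x) / 2, by omega, by omega, by omega, x, x + (y - x) / 2, y, by omega, by omega,
      by omega, by omega, by omega, by omega, by omega, by omega, by omega⟩
  · by_cases h' : y + (n - (y - x)) / 2 < n
    · exact ⟨y + (n - (y - x)) / 2, by omega, by omega, by omega, x, y, y + (n - (y - x)) / 2,
        by omega, by omega, by omega, by omega, by omega, by omega, by omega, by omega, by omega⟩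
    · exact ⟨y + (n - (y - x)) / 2 - n, by omega, by omega, by omega, y + (n - (y - x)) / 2 - n,
        x, y, by omega, by omega, by omega, by omega, by omega, by omega, by omega, by omega,
        by omega⟩

/-! ### Coordinates along the path closed by the new edge -/

namespace SimpleGraph

variable {V : Type*}

/-- Each vertex hangs at height `h` above the position `i` of the path from `a` to `b`. -/
structure IsPathCoords (T : SimpleGraph V) (a b : V) (i h : V → ℕ) : Prop where
  dist_left : ∀ u, T.dist u a = h u + i u
  dist_right : ∀ u, T.dist u b + i u = h u + T.dist a b
  le : ∀ u, i u ≤ T.dist a b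

theorem IsTree.exists_isPathCoords {T : SimpleGraph V} (hT : T.IsTree) (a b : V) :
    ∃ i h, T.IsPathCoords a b i h := by
  have key : ∀ u, ∃ i h, T.dist u a = h + i ∧ T.dist u b + i = h + T.dist a b ∧
      i ≤ T.dist a b := by
    intro u
    have hp := Nat.even_iff.mp (hT.even_dist_add_dist_add_dist u a b)
    have t1 := hT.connected.dist_triangle (u := u) (v := a) (w := b)
    have t2 := hT.connected.dist_triangle (u := a) (v := u) (w := b)
    have t3 := hT.connected.dist_triangle (u := u) (v := b) (w := a)
    rw [T.dist_comm (u := a) (v := u)] at t2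
    rw [T.dist_comm (u := b) (v := a)] at t3
    -- Gromov products; parity makes the halves exact.
    exact ⟨(T.dist u a + T.dist a b - T.dist u b) / 2, (T.dist u a + T.dist u b - T.dist a b) / 2,
      by omega, by omega, by omega⟩
  choose i h hih using key
  exact ⟨i, h, fun u => (hih u).1, fun u => (hih u).2.1, fun u => (hih u).2.2⟩

namespace IsPathCoords

variable {T : SimpleGraph V} {a b : V} {i h : V → ℕ}

theorem dist_le (hc : T.IsPathCoords a b i h) (hT : T.IsTree) {u w : V} (hi : i u = i w) :
    T.dist u w ≤ h u + h w := by
  have := hT.dist_add_dist_le_max a b w u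
  rw [T.dist_comm (u := a) (v := w), T.dist_comm (u := b) (v := w)] at this
  have := hc.dist_left u
  have := hc.dist_left w
  have := hc.dist_right u
  have := hc.dist_right w
  omega

theorem dist_eq (hc : T.IsPathCoords a b i h) (hT : T.IsTree) {u w : V} (hi : i u ≠ i w) :
    T.dist u w = h u + h w + (i u - i w + (i w - i u)) := by
  have := hT.dist_add_dist_le_max a b w u
  rw [T.dist_comm (u := a) (v := w), T.dist_comm (u := b) (v := w)] at this
  have := hc.dist_left u
  have := hc.dist_left w
  have := hc.dist_right u
  have := hc.dist_right w
  omega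

/-- A route through the new edge would go around the whole cycle. -/
theorem dist_addEdge_of_eq (hc : T.IsPathCoords a b i h) (hT : T.IsTree) (hab : a ≠ b) {u w : V}
    (hi : i u = i w) : (T.addEdge s(a, b)).dist u w = T.dist u w := by
  rw [dist_addEdge hT.connected hab]
  have := hc.dist_le hT hi
  have := hc.dist_left u
  have := hc.dist_left w
  have := hc.dist_right u
  have := hc.dist_right w
  have := hc.le u
  omega

theorem dist_addEdge_of_ne (hc : T.IsPathCoords a b i h) (hT : T.IsTree) (hab : a ≠ b) {u w : V}
    (hi : i u ≠ i w) :
    (T.addEdge s(a, b)).dist u w = h u + h w + cycDist (T.dist a b + 1) (i u) (i w) := by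
  rw [SimpleGraph.dist_addEdge hT.connected hab, cycDist]
  have := hc.dist_eq hT hi
  have := hc.dist_left u
  have := hc.dist_left w
  have := hc.dist_right u
  have := hc.dist_right w
  have := hc.le u
  have := hc.le w
  omega

theorem dist_addEdge_le (hc : T.IsPathCoords a b i h) (hT : T.IsTree) (hab : a ≠ b) (u w : V) :
    (T.addEdge s(a, b)).dist u w ≤ h u + h w + cycDist (T.dist a b + 1) (i u) (i w) := by
  by_cases hi : i u = i w
  · rw [hc.dist_addEdge_of_eq hT hab hi]
    exact (hc.dist_le hT hi).trans (Nat.le_add_right _ _)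
  · exact (hc.dist_addEdge_of_ne hT hab hi).le

theorem exists_vertex (hc : T.IsPathCoords a b i h) (hT : T.IsTree) {k : ℕ}
    (hk : k ≤ T.dist a b) : ∃ p, i p = k ∧ h p = 0 := by
  obtain ⟨p, h1, h2⟩ := hT.connected.exists_dist_eq_of_le a b hk
  refine ⟨p, ?_⟩
  have := hc.dist_left p
  have := hc.dist_right p
  rw [T.dist_comm] at h1
  omega

/-- Two vertices over the same position are resolved in `T + e` whenever they are in `T`. -/
theorem dist_eq_of_dist_addEdge_eq (hc : T.IsPathCoords a b i h) (hT : T.IsTree) (hab : a ≠ b)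
    {u v w : V} (hi : i u = i v)
    (hd : (T.addEdge s(a, b)).dist u w = (T.addEdge s(a, b)).dist v w) :
    T.dist u w = T.dist v w := by
  by_cases hw : i u = i w
  · rwa [hc.dist_addEdge_of_eq hT hab hw, hc.dist_addEdge_of_eq hT hab (hi ▸ hw)] at hd
  · have hw' : i v ≠ i w := hi ▸ hw
    rw [hc.dist_addEdge_of_ne hT hab hw, hc.dist_addEdge_of_ne hT hab hw', hi] at hd
    rw [hc.dist_eq hT hw, hc.dist_eq hT hw', hi]
    omega

theorem isResolvingSet_addEdge_of_forall_ne [DecidableEq V] (hc : T.IsPathCoords a b i h)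
    (hT : T.IsTree) (hab : a ≠ b) {W : Finset V} (hW : T.IsResolvingSet W) {x : V}
    (hne : ∀ u v, i u ≠ i v → ∃ w ∈ insert x W, (T.addEdge s(a, b)).Resolves w u v) :
    (T.addEdge s(a, b)).IsResolvingSet (insert x W) := by
  intro u v huv
  by_cases hi : i u = i v
  · obtain ⟨w, hw, hr⟩ := hW u v huv
    exact ⟨w, Finset.mem_insert_of_mem hw,
      fun hd => hr (hc.dist_eq_of_dist_addEdge_eq hT hab hi hd)⟩
  · exact hne u v hi

theorem exists_isResolvingSet_of_ne [DecidableEq V] (hc : T.IsPathCoords a b i h)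
    (hT : T.IsTree) (hab : 2 ≤ T.dist a b) {W : Finset V} (hW : T.IsResolvingSet W) {w₀ w₁ : V}
    (h₀ : w₀ ∈ W) (h₁ : w₁ ∈ W) (hlt : i w₀ < i w₁) :
    ∃ x, (T.addEdge s(a, b)).IsResolvingSet (insert x W) := by
  have hne : a ≠ b := by rintro rfl; simp at hab
  obtain ⟨k, hk, -, -, p, q, r, hpq, hqr, hr, h1, h2, h3, hp', hq', hr'⟩ :=
    exists_geodesic_triple (n := T.dist a b + 1) (by omega) hlt (Nat.lt_succ_of_le (hc.le w₁))
  obtain ⟨x, hx, -⟩ := hc.exists_vertex hT (Nat.le_of_lt_succ hk)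
  refine ⟨x, hc.isResolvingSet_addEdge_of_forall_ne hT hne hW fun u v huv => ?_⟩
  have hmem : ∀ t, (t = i w₀ ∨ t = i w₁ ∨ t = k) → ∃ w ∈ insert x W, i w = t := by
    rintro t (rfl | rfl | rfl)
    · exact ⟨w₀, Finset.mem_insert_of_mem h₀, rfl⟩
    · exact ⟨w₁, Finset.mem_insert_of_mem h₁, rfl⟩
    · exact ⟨x, Finset.mem_insert_self _ _, hx⟩
  by_contra! hno
  simp only [Resolves, not_not] at hno
  have hu : i u < T.dist a b + 1 := Nat.lt_succ_of_le (hc.le u)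
  have hv : i v < T.dist a b + 1 := Nat.lt_succ_of_le (hc.le v)
  have clamp : ∀ t, t < T.dist a b + 1 → (t = i w₀ ∨ t = i w₁ ∨ t = k) →
      (cycDist (T.dist a b + 1) (i u) t : ℤ) - cycDist (T.dist a b + 1) (i v) t =
      max (-(cycDist (T.dist a b + 1) (i u) (i v) : ℤ))
        (min (cycDist (T.dist a b + 1) (i u) (i v)) ((h v : ℤ) - h u)) := by
    intro t ht hmt
    obtain ⟨w, hw, rfl⟩ := hmem t hmt
    exact cycDist_sub_eq_clamp (p := (T.addEdge s(a, b)).dist u w) (c := h w) hu hv ht huv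
      (hc.dist_addEdge_le hT hne u w) (hc.dist_addEdge_of_ne hT hne)
      (hno w hw ▸ hc.dist_addEdge_le hT hne v w)
      (fun hvw => hno w hw ▸ hc.dist_addEdge_of_ne hT hne hvw)
  have c1 := clamp p (by omega) hp'
  have c2 := clamp q (by omega) hq'
  have c3 := clamp r (by omega) hr'
  exact huv (cycDist_geodesic_triple_resolves hu hv hpq hqr hr h1 h2 h3 (by omega) (by omega))

/-- A set contained in the branch at an inner vertex of the path does not resolve the tree. -/
theorem not_isResolvingSet (hc : T.IsPathCoords a b i h) (hT : T.IsTree) {W : Finset V} {k : ℕ}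
    (h0 : 0 < k) (hk : k < T.dist a b) (hW : ∀ w ∈ W, i w = k) : ¬ T.IsResolvingSet W := by
  intro hres
  obtain ⟨p, hp, hp0⟩ := hc.exists_vertex hT (k := k - 1) (by omega)
  obtain ⟨q, hq, hq0⟩ := hc.exists_vertex hT (k := k + 1) (by omega)
  obtain ⟨w, hw, hr⟩ := hres p q (by rintro rfl; omega)
  have := hW w hw
  apply hr
  rw [hc.dist_eq hT (by omega), hc.dist_eq hT (by omega)]
  omega

end IsPathCoords

/-! ### Resolving sets within the branch at one end -/

theorem exists_isResolvingSet_addEdge_of_branch [Fintype V] [DecidableEq V] {T : SimpleGraph V}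
    (hT : T.IsTree) {a b : V} (hab : 2 ≤ T.dist a b) {W : Finset V} (hW : T.IsResolvingSet W)
    {w₀ : V} (h₀ : w₀ ∈ W) (hbr : ∀ w ∈ W, T.dist w b = T.dist w a + T.dist a b) :
    ∃ x, (T.addEdge s(a, b)).IsResolvingSet (insert x W) := by
  have hne : a ≠ b := by rintro rfl; simp at hab
  obtain ⟨i, h, hc⟩ := hT.exists_isPathCoords a b
  have hiW : ∀ w ∈ W, i w = 0 := fun w hw => by
    have := hc.dist_left w
    have := hc.dist_right w
    have := hbr w hw
    omega
  have hib : i b = T.dist a b ∧ h b = 0 := by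
    have := hc.dist_left b
    have := hc.dist_right b
    rw [dist_self] at this
    have := T.dist_comm (u := a) (v := b)
    omega
  have inj : ∀ u v, i u ≠ 0 → i v ≠ 0 → T.dist u a = T.dist v a → u = v := by
    intro u v hu hv huv
    by_contra huv'
    obtain ⟨w, hw, hr⟩ := hW u v huv'
    apply hr
    have := hiW w hw
    rw [hc.dist_left, hc.dist_left] at huv
    rw [hc.dist_eq hT (by omega), hc.dist_eq hT (by omega)]
    omega
  obtain ⟨x, hx, hmax⟩ := Finset.exists_max_image (Finset.univ.filter fun v => i v ≠ 0)
    (fun v => T.dist v a) ⟨b, by simp; omega⟩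
  simp only [Finset.mem_filter, Finset.mem_univ, true_and] at hx hmax
  -- outside the branch at `a` the tree is a path ending in `x`
  have path : ∀ u, i u ≠ 0 → T.dist u x + T.dist u a = T.dist x a := by
    intro u hu
    obtain ⟨p, hp, hp'⟩ := hT.connected.exists_dist_eq_of_le a x (k := T.dist u a)
      (by rw [T.dist_comm (u := a)]; exact hmax u hu)
    rw [T.dist_comm (u := a)] at hp hp'
    have hp0 : i p ≠ 0 := by
      intro hp0
      have := hc.dist_eq hT (u := p) (w := x) (by omega)
      have := hc.dist_left p
      have := hc.dist_left x
      have := hc.dist_left u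
      omega
    rw [inj u p hu hp0 hp.symm] at hp' ⊢
    exact hp'
  have hix : i x = T.dist a b := by
    by_contra hix
    have := path b (by omega)
    have := hc.dist_eq hT (u := b) (w := x) (by omega)
    have := hc.dist_left b
    have := hc.dist_left x
    have := hc.le x
    omega
  have hxG : ∀ u, i u ≠ 0 → i u ≠ T.dist a b → h u = 0 ∧
      (T.addEdge s(a, b)).dist u x = h x + cycDist (T.dist a b + 1) (i u) (T.dist a b) := by
    intro u hu hu'
    have := path u hu
    have := hc.dist_eq hT (u := u) (w := x) (by omega)
    have := hc.dist_left u
    have := hc.dist_left x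
    have := hc.le u
    have := hc.dist_addEdge_of_ne hT hne (u := u) (w := x) (by omega)
    rw [hix] at this
    omega
  have hxG' : ∀ u, i u = T.dist a b → (T.addEdge s(a, b)).dist u x + h u = h x := by
    intro u hu
    have := path u (by omega)
    have := hc.dist_left u
    have := hc.dist_left x
    have := hc.dist_addEdge_of_eq hT hne (u := u) (w := x) (by omega)
    omega
  have hwG : ∀ u, i u ≠ 0 → ∀ w ∈ W,
      (T.addEdge s(a, b)).dist u w = h u + h w + cycDist (T.dist a b + 1) (i u) 0 := by
    intro u hu w hw
    have := hiW w hw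
    rw [hc.dist_addEdge_of_ne hT hne (by omega), this]
  -- a vertex of the branch at `a` against one outside
  have mixed : ∀ u v, i u = 0 → i v ≠ 0 →
      (∀ w ∈ insert x W, (T.addEdge s(a, b)).dist u w = (T.addEdge s(a, b)).dist v w) → False := by
    intro u v hu hv hno
    have e0 := hno x (Finset.mem_insert_self _ _)
    have e1 := hc.dist_addEdge_of_ne hT hne (u := u) (w := x) (by omega)
    rw [hu, hix, cycDist_last (Nat.zero_le _)] at e1
    by_cases hv' : i v = T.dist a b
    · have := hxG' v hv'
      omega
    obtain ⟨hv0, e2⟩ := hxG v hv hv'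
    have e3 := hc.dist_addEdge_of_eq hT hne (u := u) (w := w₀) (by rw [hu, hiW w₀ h₀])
    have e4 := hc.dist_le hT (u := u) (w := w₀) (by rw [hu, hiW w₀ h₀])
    have e5 := hwG v hv w₀ h₀
    have e6 := hno w₀ (Finset.mem_insert_of_mem h₀)
    have hvle := hc.le v
    -- Equal distances to `x` give `h u ≤ i v` and `h u < T.dist a b - i v`; those to `w₀` bound `h
    -- u` from below.
    have e7 : cycDist (T.dist a b + 1) (i v) 0 = h u ∧ h u ≤ T.dist a b := by
      rw [cycDist_last hvle] at e2
      rw [cycDist_zero_right] at e5 ⊢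
      omega
    have hpos := cycDist_pos (n := T.dist a b + 1) (i := i v) (j := 0) (by omega) (by omega) hv
    -- In `T`, the path vertex at position `h u` has the same distances to `W` as `u`.
    obtain ⟨p, hp, hp0⟩ := hc.exists_vertex hT e7.2
    obtain ⟨w, hw, hr⟩ := hW u p (by rintro rfl; omega)
    apply hr
    have hw0 := hiW w hw
    rw [← hc.dist_addEdge_of_eq hT hne (by omega), hno w (Finset.mem_insert_of_mem hw),
      hwG v hv w hw, hc.dist_eq hT (u := p) (w := w) (by omega)]
    omega
  refine ⟨x, hc.isResolvingSet_addEdge_of_forall_ne hT hne hW fun u v huv => ?_⟩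
  by_contra! hno
  simp only [Resolves, not_not] at hno
  by_cases hu : i u = 0
  · exact mixed u v hu (by omega) hno
  by_cases hv : i v = 0
  · exact mixed v u hv hu fun w hw => (hno w hw).symm
  have e0 := hno x (Finset.mem_insert_self _ _)
  have e1 := hno w₀ (Finset.mem_insert_of_mem h₀)
  rw [hwG u hu w₀ h₀, hwG v hv w₀ h₀, cycDist_zero_right, cycDist_zero_right] at e1
  have cu := cycDist_last (hc.le u)
  have cv := cycDist_last (hc.le v)
  have := hc.le u
  have := hc.le v
  by_cases hu' : i u = T.dist a b
  · have := hxG' u hu'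
    have := hxG v hv (by omega)
    omega
  by_cases hv' : i v = T.dist a b
  · have := hxG' v hv'
    have := hxG u hu (by omega)
    omega
  -- If the positions differ, `w₀` forces `i u + i v = T.dist a b + 1`, whereas `x` forces `T.dist a
  -- b - 1`.
  have := hxG v hv hv'
  have := hxG u hu hu'
  omega

/-! ### The upper bound and the theorem -/

theorem IsTree.metricDim_addEdge_le [Fintype V] {T : SimpleGraph V} (hT : T.IsTree) {a b : V}
    (hab : 2 ≤ T.dist a b) : (T.addEdge s(a, b)).metricDim ≤ T.metricDim + 1 := by
  classical
  have hne : a ≠ b := by rintro rfl; simp at hab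
  obtain ⟨W, hW, hcard⟩ := hT.connected.exists_isResolvingSet_card_eq_metricDim
  suffices ∃ x, (T.addEdge s(a, b)).IsResolvingSet (insert x W) by
    obtain ⟨x, hx⟩ := this
    exact (metricDim_le hx).trans (hcard ▸ Finset.card_insert_le x W)
  obtain ⟨w₀, h₀, -⟩ := hW a b hne
  obtain ⟨i, h, hc⟩ := hT.exists_isPathCoords a b
  by_cases hall : ∀ w ∈ W, i w = i w₀
  · by_cases hk0 : i w₀ = 0
    · refine exists_isResolvingSet_addEdge_of_branch hT hab hW h₀ fun w hw => ?_
      have := hall w hw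
      have := hc.dist_left w
      have := hc.dist_right w
      omega
    by_cases hkL : i w₀ = T.dist a b
    · rw [Sym2.eq_swap]
      rw [T.dist_comm] at hab
      refine exists_isResolvingSet_addEdge_of_branch hT hab hW h₀ fun w hw => ?_
      have := hall w hw
      have := hc.dist_left w
      have := hc.dist_right w
      have := T.dist_comm (u := a) (v := b)
      omega
    · exact absurd hW (hc.not_isResolvingSet hT (Nat.pos_of_ne_zero hk0)
        (lt_of_le_of_ne (hc.le w₀) hkL) hall)
  · push Not at hall
    obtain ⟨w₁, h₁, hw⟩ := hall
    rcases lt_or_gt_of_ne hw with hlt | hlt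
    · exact hc.exists_isResolvingSet_of_ne hT hab hW h₁ h₀ hlt
    · exact hc.exists_isResolvingSet_of_ne hT hab hW h₀ h₁ hlt

end SimpleGraph

theorem theorem3p1 {V : Type*} [Fintype V] (T : SimpleGraph V) (hT : T.IsTree)
    (hcard : 3 ≤ Fintype.card V) (e : Sym2 V) (he : e ∈ Tᶜ.edgeSet) :
    (T.metricDim : ℤ) - 2 ≤ ((T.addEdge e).metricDim : ℤ) ∧
      ((T.addEdge e).metricDim : ℤ) ≤ (T.metricDim : ℤ) + 1 := by
  induction e using Sym2.ind with
  | _ a b =>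
    rw [SimpleGraph.mem_edgeSet, SimpleGraph.compl_adj] at he
    have h1 := SimpleGraph.metricDim_le_metricDim_addEdge_add_two hT.connected he.1
    have h2 := hT.metricDim_addEdge_le (hT.connected.one_lt_dist_of_ne_of_not_adj he.1 he.2)
    omega
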